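/- Let $R$ be a commutative noetherian local ring that is reduced and has Krull dimension $d \ge 2$, and let $a$ be a unit of $R$. Let $u_0, u_1, \ldots, u_d \in R[X]$ be such that the row $(a u_0, u_1, \ldots, u_d)$ of length $d+1$ is unimodular over $R[X]$, i.e. its entries generate the unit ideal of $R[X]$. Let $E_{d+1}(R[X])$ be the subgroup of $GL_{d+1}(R[X])$ generated by the matrices $I + \lambda E_{ij}$ with $\lambda \in R[X]$, $i \ne j$, acting on rows by right multiplication. Then there exist $v_0, v_1 \in R[X]$ and $c_2, \ldots, c_d \in R$ such that the row $(v_0, v_1, c_2, \ldots, c_d)$ is unimodular over $R[X]$, $\deg v_1 = 1$, $c_d$ is a non-zero-divisor of $R$, and $$(a v_0, v_1, c_2, \ldots, c_d) = (a u_0, u_1, \ldots, u_d)\,\varepsilon \quad\text{for some } \varepsilon \in E_{d+1}(R[X]).$$ -/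

import Mathlib

/-- A row `v` over a commutative ring is unimodular if `∑ i, v i * w i = 1` for some row `w`. -/
def IsUnimodularRow {A ι : Type*} [CommRing A] [Fintype ι] (v : ι → A) : Prop :=
  ∃ w : ι → A, ∑ i, v i * w i = 1

/-- The elementary group: the subgroup of the general linear group generated by the matrices
`1 + c E_ij` with `i ≠ j`. -/
def elementarySubgroup (ι A : Type*) [CommRing A] [Fintype ι] [DecidableEq ι] :
    Subgroup (Matrix.GeneralLinearGroup ι A) :=
  Subgroup.closure
    {g | ∃ (i j : ι) (c : A), i ≠ j ∧ (g : Matrix ι ι A) = Matrix.transvection i j c}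

/-- Two rows are elementarily equivalent if they lie in the same orbit of the elementary group
acting on rows by right multiplication. -/
def ElementarilyEquivalent {A ι : Type*} [CommRing A] [Fintype ι] [DecidableEq ι]
    (v w : ι → A) : Prop :=
  ∃ g ∈ elementarySubgroup ι A, Matrix.vecMul v (g : Matrix ι ι A) = w

/-! The row is brought to normal form with the help of a single non-zero-divisor `c` in the maximal
ideal of the reduced local ring `R` of dimension `d = n + 1`. Both `R/c` and `R[1/c]` have dimension
at most `n`.

Over `(R/c)[X]` the length `n + 2` of the row exceeds `dim R/c` by at least two, so it is equivalent
to a coordinate row (`single_of_card`): by general position (`exists_add_mul_card_le_height`) all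
entries but one generate an ideal whose primes have height larger than the dimension of the
coefficient ring, such primes contain monic polynomials (`exists_monic_mem_of_height`), and a row
with a monic entry is handled by the elementary form of Horrocks' theorem (`single_of_monic`).
Lifting the operations gives a row over `R[X]` with an entry `f` which is a unit modulo `c`, and
conversely `c` is a unit modulo `f`. By Roitman's lemma (`update_sq_mul`) all other entries may then
be multiplied by even powers of `c`, so operations on them may use denominators that are powers of
`c` (`exists_update_map_eq`); only `f` has to be treated with integral operations, and it is changed
by multiples of `c` alone.

This makes the leading coefficient of an entry `g` a power of `c`
(`exists_equivalent_leadingCoeff_eq_pow`). While `m = deg g ≥ 2`, the degree is lowered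
(`exists_equivalent_natDegree_eq_pred`). Let `h` be one of the other entries, and consider the
remainders modulo `g` of the `n` entries other than `g` and `h`. They have `n m > n ≥ dim R[1/c]`
coefficients in `R[1/c]`, to which multiples of an element `s` of `(g, h) ∩ R` can be added by adding
multiples of `h` to the entries. As `s` can be chosen comaximal with these coefficients
(`exists_C_mem_span_pair`), general position makes them generate the unit ideal of `R[1/c]`.
Suslin's degree reduction (`exists_monic_natDegree_pred_sub_mem`) then gives `h` the degree `m - 1`
and a power of `c` as leading coefficient, and `h` takes the place of `g`.

Once `g` is linear, the entries other than `f` and `g` are replaced by their values at the root of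
`g` in `R[1/c]`, up to powers of `c`. The last one becomes a non-zero-divisor after a prior
modification that avoids the minimal primes of `R`. The unit `a` plays no role, since it can be
absorbed into the entry `v 0`. -/

open Polynomial

/-! ### Unimodular rows and elementary equivalence -/

section ElementaryRows

variable {A B ι : Type*} [CommRing A] [CommRing B] [Fintype ι]

theorem isUnimodularRow_iff_span_eq_top {v : ι → A} :
    IsUnimodularRow v ↔ Ideal.span (Set.range v) = ⊤ := by
  rw [Ideal.eq_top_iff_one, Ideal.mem_span_range_iff_exists_fun]
  simp only [IsUnimodularRow, mul_comm]

theorem IsUnimodularRow.map {v : ι → A} (hv : IsUnimodularRow v) (φ : A →+* B) :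
    IsUnimodularRow (fun i => φ (v i)) := by
  obtain ⟨w, hw⟩ := hv
  refine ⟨fun i => φ (w i), ?_⟩
  simp only [← map_mul, ← map_sum, hw, map_one]

/-- A proper ideal misses some entry of a unimodular row. -/
theorem IsUnimodularRow.exists_notMem {v : ι → A} (hv : IsUnimodularRow v) {P : Ideal A}
    (hP : P ≠ ⊤) : ∃ i, v i ∉ P := by
  by_contra! h
  apply hP
  rw [eq_top_iff, ← isUnimodularRow_iff_span_eq_top.1 hv, Ideal.span_le]
  rintro _ ⟨i, rfl⟩
  exact h i

variable [DecidableEq ι]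

namespace ElementarilyEquivalent

theorem refl (v : ι → A) : ElementarilyEquivalent v v := ⟨1, one_mem _, by simp⟩

theorem symm {v w : ι → A} (h : ElementarilyEquivalent v w) : ElementarilyEquivalent w v := by
  obtain ⟨g, hg, rfl⟩ := h
  refine ⟨g⁻¹, inv_mem hg, ?_⟩
  rw [Matrix.vecMul_vecMul, Units.mul_inv, Matrix.vecMul_one]

theorem trans {u v w : ι → A} (h : ElementarilyEquivalent u v)
    (h' : ElementarilyEquivalent v w) : ElementarilyEquivalent u w := by
  obtain ⟨g, hg, rfl⟩ := h
  obtain ⟨g', hg', rfl⟩ := h'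
  exact ⟨g * g', mul_mem hg hg', by rw [Matrix.vecMul_vecMul]; rfl⟩

end ElementarilyEquivalent

/-- The transvection `1 + c E_ij` as an element of the general linear group. -/
def transvectionUnit (i j : ι) (hij : i ≠ j) (c : A) : Matrix.GeneralLinearGroup ι A where
  val := Matrix.transvection i j c
  inv := Matrix.transvection i j (-c)
  val_inv := by rw [Matrix.transvection_mul_transvection_same _ _ hij, add_neg_cancel,
    Matrix.transvection_zero]
  inv_val := by rw [Matrix.transvection_mul_transvection_same _ _ hij, neg_add_cancel,
    Matrix.transvection_zero]

theorem transvectionUnit_mem (i j : ι) (hij : i ≠ j) (c : A) :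
    transvectionUnit i j hij c ∈ elementarySubgroup ι A :=
  Subgroup.subset_closure ⟨i, j, c, hij, rfl⟩

theorem vecMul_transvection (v : ι → A) (i j : ι) (c : A) :
    Matrix.vecMul v (Matrix.transvection i j c) = Function.update v j (v j + c * v i) := by
  ext l
  rw [Matrix.transvection, Matrix.vecMul_add, Matrix.vecMul_one, Pi.add_apply]
  have h0 : Matrix.vecMul v (Matrix.single i j c) l = if j = l then v i * c else 0 := by
    simp [Matrix.vecMul, dotProduct, Matrix.single_apply, ite_and]
  rw [h0]
  rcases eq_or_ne l j with rfl | h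
  · simp [mul_comm]
  · simp [h, h.symm]

namespace ElementarilyEquivalent

theorem update_add (v : ι → A) {i j : ι} (hij : i ≠ j) (c : A) :
    ElementarilyEquivalent v (Function.update v j (v j + c * v i)) :=
  ⟨transvectionUnit i j hij c, transvectionUnit_mem i j hij c, vecMul_transvection v i j c⟩

theorem of_eq_add {v w : ι → A} {i j : ι} (hij : i ≠ j) (c : A) (hj : w j = v j + c * v i)
    (hw : ∀ l, l ≠ j → w l = v l) : ElementarilyEquivalent v w := by
  convert update_add v hij c using 1
  ext l
  by_cases h : l = j
  · subst h; simp [hj]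
  · simp [h, hw l h]

/-- Elements of the ideal generated by the other entries may be added to an entry. -/
theorem update_add_of_mem_span (v : ι → A) (j : ι) {y : A}
    (hy : y ∈ Ideal.span (v '' {j}ᶜ)) :
    ElementarilyEquivalent v (Function.update v j (v j + y)) := by
  suffices H : ∀ c a : A, ElementarilyEquivalent (Function.update v j a)
      (Function.update v j (a + c * y)) by simpa using H 1 (v j)
  refine Submodule.span_induction (p := fun y _ => ∀ c a : A, ElementarilyEquivalent
    (Function.update v j a) (Function.update v j (a + c * y))) ?_ ?_ ?_ ?_ hy
  · rintro _ ⟨i, hi, rfl⟩ c a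
    have hij : i ≠ j := hi
    simpa [hij] using update_add (Function.update v j a) hij c
  · intro c a
    simpa using refl _
  · intro x y _ _ hx hy c a
    have := (hx c a).trans (hy c _)
    rwa [add_assoc, ← mul_add] at this
  · intro b x _ hx c a
    simpa [mul_assoc] using hx (c * b) a

/-- Multiples of one entry may be added to all others simultaneously. -/
theorem add_smul_of_ne (v : ι → A) (j : ι) (l : ι → A) (s : Finset ι) (hj : j ∉ s) :
    ElementarilyEquivalent v (fun i => if i ∈ s then v i + l i * v j else v i) := by
  induction s using Finset.induction_on with
  | empty => simpa using refl v
  | insert a s ha ih =>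
    have hja : j ≠ a := fun h => hj (by simp [h])
    have hjs : j ∉ s := fun h => hj (by simp [h])
    refine (ih hjs).trans ?_
    convert update_add _ hja (l a) using 1
    ext i
    rcases eq_or_ne i a with rfl | h
    · simp [ha, hjs]
    · simp [h]

/-- Two entries may be exchanged up to a sign. -/
theorem swap (v : ι → A) {i j : ι} (hij : i ≠ j) :
    ElementarilyEquivalent v (Function.update (Function.update v i (v j)) j (-v i)) := by
  refine (of_eq_add (w := Function.update v i (v i + v j)) hij.symm 1 (by simp)
    fun l hl => by simp [hl]).trans ?_
  refine (of_eq_add (w := Function.update (Function.update v i (v i + v j)) j (-v i)) hij (-1)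
    (by simp [hij.symm]) fun l hl => by simp [hl]).trans ?_
  refine of_eq_add hij.symm 1 (by simp [hij]) fun l hl => ?_
  by_cases h : l = j
  · subst h; simp
  · simp [h, hl]

theorem isUnimodularRow {v w : ι → A} (h : ElementarilyEquivalent v w)
    (hv : IsUnimodularRow v) : IsUnimodularRow w := by
  obtain ⟨g, -, rfl⟩ := h
  obtain ⟨u, hu⟩ := hv
  refine ⟨Matrix.mulVec (g⁻¹ : Matrix.GeneralLinearGroup ι A).1 u, ?_⟩
  change (Matrix.vecMul v g.1) ⬝ᵥ (Matrix.mulVec (g⁻¹ : Matrix.GeneralLinearGroup ι A).1 u) = 1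
  rw [Matrix.dotProduct_mulVec, Matrix.vecMul_vecMul, Units.mul_inv, Matrix.vecMul_one]
  exact hu

/-- Elementary equivalences lift along surjective ring homomorphisms, because transvections do. -/
theorem lift {φ : A →+* B} (hφ : Function.Surjective φ) {v : ι → A} {w : ι → B}
    (h : ElementarilyEquivalent (fun i => φ (v i)) w) :
    ∃ v' : ι → A, ElementarilyEquivalent v v' ∧ ∀ i, φ (v' i) = w i := by
  obtain ⟨g, hg, rfl⟩ := h
  have hle : elementarySubgroup ι B ≤
      (elementarySubgroup ι A).map (Matrix.GeneralLinearGroup.map φ) := by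
    rw [elementarySubgroup, Subgroup.closure_le]
    rintro g ⟨i, j, c, hij, hg⟩
    obtain ⟨c, rfl⟩ := hφ c
    refine ⟨transvectionUnit i j hij c, transvectionUnit_mem i j hij c, Units.ext ?_⟩
    rw [hg]
    ext k l
    simp [transvectionUnit, Matrix.transvection, Matrix.one_apply, Matrix.single_apply, apply_ite φ]
  obtain ⟨g', hg', rfl⟩ := hle hg
  refine ⟨Matrix.vecMul v g'.1, ⟨g', hg', rfl⟩, fun i => ?_⟩
  simp [Matrix.vecMul, dotProduct]

/-- If an entry is `1`, the row is equivalent to any coordinate row. -/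
theorem single_of_eq_one {v : ι → A} {k : ι} (hk : v k = 1) {i : ι} (hki : k ≠ i) :
    ElementarilyEquivalent v (Pi.single i 1) := by
  have h1 : ElementarilyEquivalent v (Function.update v i 1) := by
    simpa [hk] using update_add v hki (1 - v i)
  refine h1.trans ?_
  have h2 := add_smul_of_ne (Function.update v i 1) i (fun l => - v l) (Finset.univ.erase i)
    (by simp)
  convert h2 using 1
  ext l
  by_cases h : l = i
  · subst h; simp
  · simp [h]

end ElementarilyEquivalent

end ElementaryRows

/-! ### Multiplying an entry by a square -/

namespace ElementarilyEquivalent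

variable {A ι : Type*} [CommRing A] [Fintype ι] [DecidableEq ι]

theorem sum_mul_sub_mem_span (x u : ι → A) (i : ι) :
    ∑ l, x l * u l - x i * u i ∈ Ideal.span (x '' {i}ᶜ) := by
  rw [← Finset.add_sum_erase _ _ (Finset.mem_univ i), add_sub_cancel_left]
  refine Ideal.sum_mem _ fun l hl => Ideal.mul_mem_right _ _ (Ideal.subset_span ⟨l, ?_, rfl⟩)
  exact Finset.ne_of_mem_erase hl

theorem sum_update_mul (x u : ι → A) (j : ι) (y : A) :
    ∑ l, Function.update x j y l * u l = ∑ l, x l * u l + (y - x j) * u j := by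
  rw [← Finset.add_sum_erase _ _ (Finset.mem_univ j),
    ← Finset.add_sum_erase Finset.univ (fun l => x l * u l) (Finset.mem_univ j),
    Finset.sum_congr rfl fun l hl => by
      rw [Function.update_of_ne (Finset.ne_of_mem_erase hl)]]
  simp only [Function.update_self]
  ring

theorem sum_mul_update (x u : ι → A) (j : ι) (y : A) :
    ∑ l, x l * Function.update u j y l = ∑ l, x l * u l + x j * (y - u j) := by
  have := sum_update_mul u x j y
  simp only [mul_comm _ (x _)] at this
  exact this

/-- If `x ⬝ᵥ u = 1`, then the matrix `1 + l u (u_j e_k - u_k e_j)ᵀ` is elementary, as soon as there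
is a third index `i`. Its action on `x` is realised as a commutator of operations passing through
the entry `x_i`. -/
theorem add_mul_companion {x u : ι → A} (hxu : ∑ l, x l * u l = 1) {i j k : ι} (hij : i ≠ j)
    (hik : i ≠ k) (hjk : j ≠ k) (l : A) :
    ElementarilyEquivalent x
      (Function.update (Function.update x j (x j - l * u k)) k (x k + l * u j)) := by
  set f1 := x i + l * (1 - x i * u i) with hf1
  set x1 := Function.update x i f1 with hx1
  set x2 := Function.update (Function.update x1 j (x j - u k * f1)) k (x k + u j * f1) with hx2
  have h1 : ElementarilyEquivalent x x1 := by
    refine update_add_of_mem_span x i (Ideal.mul_mem_left _ _ ?_)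
    rw [← hxu]
    exact sum_mul_sub_mem_span x u i
  have h2 : ElementarilyEquivalent x1 x2 := by
    refine (of_eq_add (w := Function.update x1 j (x j - u k * f1)) hij (-u k) ?_
      fun m hm => by simp [hm]).trans ?_
    · simp [x1, hij.symm]; ring
    · refine of_eq_add hik (u j) ?_ fun m hm => by simp [x2, hm]
      simp [x1, x2, hik.symm, hij, hjk.symm]
  have hs : ∑ m, x2 m * u m - x2 i * u i = 1 - x i * u i := by
    rw [hx2, sum_update_mul, sum_update_mul, hx1, sum_update_mul, hxu]
    simp only [ne_eq, hjk.symm, not_false_eq_true, Function.update_of_ne, hik.symm, hij.symm, hij,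
      hik, Function.update_self, hf1]
    ring
  have h3 : ElementarilyEquivalent x2 (Function.update x2 i (x i)) := by
    have hm := Ideal.mul_mem_left _ (-l) (sum_mul_sub_mem_span x2 u i)
    have := update_add_of_mem_span x2 i hm
    rw [hs] at this
    convert this using 2
    simp only [x2, x1, f1, ne_eq, hij, hik, not_false_eq_true, Function.update_of_ne,
      Function.update_self]
    ring
  refine h1.trans (h2.trans (h3.trans ?_))
  refine (of_eq_add (w := Function.update (Function.update x2 i (x i)) j (x j - l * u k)) hij
    (u k * (1 - l * u i)) ?_ fun m hm => by simp [hm]).trans ?_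
  · simp only [x2, x1, f1, ne_eq, hij.symm, hjk, not_false_eq_true, Function.update_of_ne,
      Function.update_self]
    ring
  refine of_eq_add hik (-u j * (1 - l * u i)) ?_ fun m hm => ?_
  · simp only [x2, x1, f1, ne_eq, hij, hik.symm, hjk.symm, not_false_eq_true, Function.update_of_ne,
      Function.update_self]
    ring
  · by_cases hmj : m = j
    · subst hmj; simp [hm]
    · by_cases hmi : m = i
      · subst hmi; simp [hm, hij]
      · simp [x2, x1, hm, hmj, hmi]

/-- Two entries of a unimodular row may be multiplied by an element that is a unit modulo a third
entry. With the companion row `(-u_k, u_j)` as second row below `(x_j, x_k)`, multiples of the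
second row are added to the first by `add_mul_companion`, and multiples of the first row may be
added to the second freely; `diag(t, t⁻¹)` is a product of such operations modulo `x i`. -/
theorem mul_mul {x : ι → A} (hx : IsUnimodularRow x) {i j k : ι} (hij : i ≠ j)
    (hik : i ≠ k) (hjk : j ≠ k) {t : A} (ht : IsCoprime (x i) t) :
    ElementarilyEquivalent x
      (Function.update (Function.update x j (t * x j)) k (t * x k)) := by
  obtain ⟨u, hu⟩ := hx
  obtain ⟨a, b, hab⟩ := ht
  have h1 := add_mul_companion hu hij hik hjk 1
  set x' := Function.update (Function.update x j (x j - 1 * u k)) k (x k + 1 * u j) with hx'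
  -- modulo `x i` the scalar `μ` is `t⁻¹ - 1`
  set μ := b * (1 - t) with hμ
  set u' := Function.update (Function.update u j (u j + μ * x' k)) k (u k - μ * x' j) with hu'
  have hu1 : ∑ l, x' l * u' l = 1 := by
    rw [hu', sum_mul_update, sum_mul_update]
    simp only [ne_eq, hjk.symm, not_false_eq_true, Function.update_of_ne]
    rw [hx', sum_update_mul, sum_update_mul, hu]
    simp only [ne_eq, hjk, hjk.symm, not_false_eq_true, Function.update_of_ne, Function.update_self]
    ring
  have h2 := add_mul_companion hu1 hij hik hjk (-t)
  refine h1.trans (h2.trans ?_)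
  have hb : b * t = 1 - a * x i := by linear_combination hab
  refine (of_eq_add (w := Function.update (Function.update x' j (t * x j)) k
    (x' k + -t * u' j)) hij (- (a * (1 - t) * (x j - u k))) ?_ fun m hm => ?_).trans ?_
  · simp only [hu', hx', ne_eq, hij, hik, hjk, not_false_eq_true,
      Function.update_of_ne, Function.update_self, hμ]
    linear_combination (x j - u k) * (1 - t) * hb
  · by_cases hmk : m = k
    · subst hmk; simp
    · simp [hm, hmk]
  · refine of_eq_add hik (- (a * (1 - t) * (x k + u j))) ?_ fun m hm => ?_
    · simp only [hu', hx', ne_eq, hij, hik, hjk, not_false_eq_true,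
        Function.update_of_ne, Function.update_self, hμ]
      linear_combination (x k + u j) * (1 - t) * hb
    · by_cases hmj : m = j
      · subst hmj; simp [hm]
      · simp [hm, hmj, hx']

/-- **Roitman's lemma**: an entry of a unimodular row of length at least three may be multiplied
by the square of an element that is a unit modulo another entry. -/
theorem update_sq_mul {x : ι → A} (hx : IsUnimodularRow x) {i j k : ι} (hij : i ≠ j)
    (hik : i ≠ k) (hjk : j ≠ k) {t : A} (ht : IsCoprime (x i) t) :
    ElementarilyEquivalent x (Function.update x j (t ^ 2 * x j)) := by
  refine (mul_mul hx hij hik hjk ht).trans ?_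
  obtain ⟨a, b, hab⟩ := ht
  have hb : b * t = 1 - a * x i := by linear_combination hab
  let T : A → A → ι → A := fun y z => Function.update (Function.update x j y) k z
  have hTj : ∀ y z, T y z j = y := fun y z => by simp [T, hjk]
  have hTk : ∀ y z, T y z k = z := fun y z => by simp [T]
  have hTi : ∀ y z, T y z i = x i := fun y z => by simp [T, hij, hik]
  have hTo : ∀ y z y' z' m, m ≠ j → m ≠ k → T y z m = T y' z' m := fun y z y' z' m hj hk => by
    simp [T, hj, hk]
  have hk : ∀ y z l {i'} (_ : i' ≠ k) (c : A), l = z + c * T y z i' →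
      ElementarilyEquivalent (T y z) (T y l) := fun y z l i' hi' c hl =>
    of_eq_add hi' c (by simp [hTk, hl]) fun m hm => by
      by_cases hmj : m = j
      · subst hmj; simp [hTj]
      · exact hTo _ _ _ _ m hmj hm
  have hj : ∀ y z l {i'} (_ : i' ≠ j) (c : A), l = y + c * T y z i' →
      ElementarilyEquivalent (T y z) (T l z) := fun y z l i' hi' c hl =>
    of_eq_add hi' c (by simp [hTj, hl]) fun m hm => by
      by_cases hmk : m = k
      · subst hmk; simp [hTk]
      · exact hTo _ _ _ _ m hm hmk
  -- the usual factorisation of `diag(t, t⁻¹)` into elementary matrices, modulo `x i`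
  have e1 := hk (t * x j) (t * x k) (t * x k + t * x j) hjk 1 (by rw [hTj]; ring)
  have e2 := hj (t * x j) (t * x k + t * x j)
    (t * x j + (t - 1) * (t * x k + t * x j)) hjk.symm (t - 1) (by rw [hTk])
  have e3 := hk (t * x j + (t - 1) * (t * x k + t * x j)) (t * x k + t * x j)
    (x k + a * x i * (x j + (t - 1) * (x k + x j))) hjk (-b) (by
      rw [hTj]; linear_combination (x j + (t - 1) * (x k + x j)) * hb)
  have e4 := hk (t * x j + (t - 1) * (t * x k + t * x j))
    (x k + a * x i * (x j + (t - 1) * (x k + x j))) (x k) hik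
    (-a * (x j + (t - 1) * (x k + x j))) (by rw [hTi]; ring)
  have e5 := hj (t * x j + (t - 1) * (t * x k + t * x j)) (x k) (t ^ 2 * x j) hjk.symm
    (-((t - 1) * t)) (by rw [hTk]; ring)
  have := e1.trans (e2.trans (e3.trans (e4.trans e5)))
  convert this using 1
  ext m
  by_cases hmk : m = k
  · subst hmk; simp [T, hjk.symm]
  · simp [T, hmk]

theorem update_pow_mul {x : ι → A} (hx : IsUnimodularRow x) {i j k : ι} (hij : i ≠ j)
    (hik : i ≠ k) (hjk : j ≠ k) {t : A} (ht : IsCoprime (x i) t) (n : ℕ) :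
    ElementarilyEquivalent x (Function.update x j (t ^ (2 * n) * x j)) := by
  have := update_sq_mul hx hij hik hjk (ht.pow_right (n := n))
  rwa [← pow_mul, mul_comm n] at this

end ElementarilyEquivalent

/-! ### General position -/

section GeneralPosition

variable {A : Type*} [CommRing A]

/-- Prime avoidance in a coset `x + I`, for finitely many pairwise incomparable primes. -/
theorem exists_add_notMem_of_incomparable (S : Finset (Ideal A)) (hS : ∀ P ∈ S, P.IsPrime)
    (hinc : ∀ P ∈ S, ∀ Q ∈ S, P ≤ Q → P = Q) (x : A) (I : Ideal A)
    (h : ∀ P ∈ S, x ∈ P → ¬ I ≤ P) : ∃ y ∈ I, ∀ P ∈ S, x + y ∉ P := by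
  classical
  let T := S.filter fun P => x ∈ P
  let J := I ⊓ (S.filter fun P => x ∉ P).inf id
  have hJ : ¬ ((J : Set A) ⊆ ⋃ P ∈ (T : Set (Ideal A)), (P : Set A)) := by
    intro hsub
    obtain ⟨P, hPT, hP⟩ := (Ideal.subset_union_prime (s := T) (f := id) ⊥ ⊥
      fun P hP _ _ => hS P (Finset.mem_filter.1 hP).1).1 hsub
    obtain ⟨hPS, hxP⟩ := Finset.mem_filter.1 hPT
    have := hS P hPS
    rcases (Ideal.IsPrime.inf_le this).1 hP with hI | hI
    · exact h P hPS hxP hI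
    · obtain ⟨Q, hQ, hQP⟩ := (Ideal.IsPrime.inf_le' this).1 hI
      obtain ⟨hQS, hxQ⟩ := Finset.mem_filter.1 hQ
      exact hxQ (hinc Q hQS P hPS hQP ▸ hxP)
  obtain ⟨y, hyJ, hyT⟩ := Set.not_subset.1 hJ
  obtain ⟨hyI, hyS⟩ := hyJ
  refine ⟨y, hyI, fun P hP hxy => ?_⟩
  by_cases hx : x ∈ P
  · exact hyT (Set.mem_biUnion (show P ∈ (T : Set _) from Finset.mem_filter.2 ⟨hP, hx⟩)
      ((Ideal.add_mem_iff_right P hx).1 hxy))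
  · have hyP : y ∈ P := (Finset.inf_le (f := id) (Finset.mem_filter.2 ⟨hP, hx⟩)) hyS
    exact hx ((Ideal.add_mem_iff_left P hyP).1 hxy)

/-- After adding suitable multiples of `a₀` to the `a j`, the primes containing all the `a j` but
not `a₀` have height at least the number of the `a j`. -/
theorem exists_add_mul_card_le_height [IsNoetherianRing A] {κ : Type*} (J : Finset κ) (a₀ : A)
    (a : κ → A) : ∃ l : κ → A, ∀ P : Ideal A, P.IsPrime → a₀ ∉ P →
      (∀ j ∈ J, a j + l j * a₀ ∈ P) → (J.card : ℕ∞) ≤ P.height := by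
  classical
  induction J using Finset.induction_on with
  | empty => exact ⟨0, fun P _ _ _ => by simp⟩
  | insert k J hk ih =>
    obtain ⟨l, hl⟩ := ih
    let I := Ideal.span ((fun j => a j + l j * a₀) '' (J : Set κ))
    have hfin : {P ∈ I.minimalPrimes | a₀ ∉ P}.Finite :=
      (I.finite_minimalPrimes_of_isNoetherianRing).subset fun P hP => hP.1
    obtain ⟨y, hy, hyP⟩ := exists_add_notMem_of_incomparable hfin.toFinset
      (fun P hP => (hfin.mem_toFinset.1 hP).1.1.1)
      (fun P hP Q hQ hPQ => le_antisymm hPQ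
        ((hfin.mem_toFinset.1 hQ).1.2 (hfin.mem_toFinset.1 hP).1.1 hPQ))
      (a k) (Ideal.span {a₀})
      (fun P hP _ hle => (hfin.mem_toFinset.1 hP).2 (hle (Ideal.mem_span_singleton_self a₀)))
    obtain ⟨c, rfl⟩ := Ideal.mem_span_singleton'.1 hy
    refine ⟨Function.update l k c, fun P hP ha hmem => ?_⟩
    have hJ : ∀ j ∈ J, a j + l j * a₀ ∈ P := fun j hj => by
      have := hmem j (Finset.mem_insert_of_mem hj)
      rwa [Function.update_of_ne (by rintro rfl; exact hk hj)] at this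
    have hIP : I ≤ P := Ideal.span_le.2 (by rintro _ ⟨j, hj, rfl⟩; exact hJ j hj)
    obtain ⟨Q, hQ, hQP⟩ := Ideal.exists_minimalPrimes_le hIP
    have hQprime : Q.IsPrime := hQ.1.1
    have haQ : a₀ ∉ Q := fun h => ha (hQP h)
    have hQh := hl Q hQprime haQ fun j hj => hQ.1.2 (Ideal.subset_span ⟨j, hj, rfl⟩)
    have hkP := hmem k (Finset.mem_insert_self k J)
    rw [Function.update_self] at hkP
    have hlt : Q < P := lt_of_le_of_ne hQP fun h =>
      hyP Q (hfin.mem_toFinset.2 ⟨hQ, haQ⟩) (h ▸ hkP)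
    rw [Finset.card_insert_of_notMem hk]
    push_cast
    exact (add_le_add_left hQh 1).trans (Ideal.height_add_one_le_of_lt_of_isPrime hlt)

end GeneralPosition

/-! ### Monic polynomials in ideals -/

section Monic

variable {A : Type*} [CommRing A]

/-- A prime of `A[X]` of height larger than `dim A` contains a monic polynomial: it is a maximal
ideal, it lies over a maximal ideal `p` of `A`, and it differs from `p[X]`. -/
theorem exists_monic_mem_of_height [IsNoetherianRing A] {n : ℕ} (hdim : ringKrullDim A ≤ n)
    (P : Ideal A[X]) [P.IsPrime] (hP : (n + 1 : ℕ) ≤ P.height) : ∃ f ∈ P, f.Monic := by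
  have hht : ∀ q : Ideal A, q.IsPrime → q.height ≤ n := fun q hq => by
    have := (Ideal.height_le_ringKrullDim_of_isPrime (I := q)).trans hdim
    exact_mod_cast this
  obtain ⟨Q, hQ, hPQ⟩ := Ideal.exists_le_maximal P Ideal.IsPrime.ne_top'
  have hQh := Polynomial.height_eq_height_add_one (Q.under A) Q
  have hPmax : P.IsMaximal := by
    rcases eq_or_lt_of_le hPQ with h | h
    · exact h ▸ hQ
    · exfalso
      have h1 := Ideal.height_add_one_le_of_lt_of_isPrime h
      have h2 : Q.height ≤ (n : ℕ∞) + 1 := by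
        rw [hQh]; exact add_le_add_left (hht _ inferInstance) 1
      have h3 := ((add_le_add_left hP 1).trans h1).trans h2
      norm_cast at h3
      omega
  set p := P.under A with hp
  have hPh := Polynomial.height_eq_height_add_one p P
  have hpn : (n : ℕ∞) ≤ p.height := by
    rw [hPh] at hP
    push_cast at hP
    exact (ENat.add_le_add_iff_right (by simp)).1 hP
  have hpmax : p.IsMaximal := by
    obtain ⟨q, hq, hpq⟩ := Ideal.exists_le_maximal p Ideal.IsPrime.ne_top'
    rcases eq_or_lt_of_le hpq with h | h
    · exact h ▸ hq
    · exfalso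
      have h1 := Ideal.height_add_one_le_of_lt_of_isPrime h
      have h3 := ((add_le_add_left hpn 1).trans h1).trans (hht q inferInstance)
      norm_cast at h3
      omega
  have hle : p.map C ≤ P := Ideal.map_le_iff_le_comap.2 le_rfl
  have hne : ¬ P ≤ p.map C := fun h => by
    have h1 := Polynomial.height_map_C p
    rw [le_antisymm hle h, hPh] at h1
    have h2 : p.height ≠ ⊤ := ne_top_of_le_ne_top (ENat.natCast_ne_top n) (hht p inferInstance)
    generalize p.height = t at h1 h2
    lift t to ℕ using h2
    norm_cast at h1
    omega
  obtain ⟨F, hFP, hF⟩ := Set.not_subset.1 hne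
  let : Field (A ⧸ p) := Ideal.Quotient.field p
  let φ := Ideal.Quotient.mk p
  have hF0 : F.map φ ≠ 0 := fun h => hF (by
    have : F ∈ RingHom.ker (mapRingHom φ) := by simpa [RingHom.mem_ker] using h
    rwa [Polynomial.ker_mapRingHom, Ideal.mk_ker] at this)
  obtain ⟨b, hb⟩ := Ideal.Quotient.mk_surjective (F.map φ).leadingCoeff⁻¹
  have hmonic : ((F * C b).map φ).Monic := by
    rw [Polynomial.map_mul, map_C, hb]
    exact monic_mul_leadingCoeff_inv hF0
  obtain ⟨G, hG, -, hGm⟩ := lifts_and_natDegree_eq_and_monic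
    ((mem_lifts _).2 ⟨F * C b, rfl⟩) hmonic
  refine ⟨G, ?_, hGm⟩
  have hker : G - F * C b ∈ RingHom.ker (mapRingHom φ) := by
    rw [RingHom.mem_ker, map_sub, coe_mapRingHom, hG, sub_self]
  rw [Polynomial.ker_mapRingHom, Ideal.mk_ker] at hker
  have := P.add_mem (hle hker) (P.mul_mem_right (C b) hFP)
  rwa [sub_add_cancel] at this

theorem exists_monic_mem_of_forall_prime (I : Ideal A[X])
    (h : ∀ P : Ideal A[X], P.IsPrime → I ≤ P → ∃ f ∈ P, f.Monic) : ∃ f ∈ I, f.Monic := by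
  let S : Submonoid A[X] :=
    { carrier := {f | f.Monic}, one_mem' := monic_one, mul_mem' := fun ha hb => ha.mul hb }
  by_contra! hI
  obtain ⟨P, hP, hIP, hd⟩ := Ideal.exists_le_prime_disjoint I S
    (Set.disjoint_left.2 fun f hf hf' => hI f hf hf')
  obtain ⟨f, hf, hfm⟩ := h P hP hIP
  exact Set.disjoint_left.1 hd hf hfm

/-- **Suslin's degree reduction**: if `I` contains a monic polynomial of degree `m` and the
coefficients of the elements of `I` of degree less than `m` generate the unit ideal, then every
class modulo `I` contains a monic polynomial of degree `m - 1`. -/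
theorem exists_monic_natDegree_pred_sub_mem [Nontrivial A] (I : Ideal A[X]) {g : A[X]}
    (hg : g.Monic) (hgI : g ∈ I) (hm : 0 < g.natDegree)
    (hI : ∀ M : Ideal A, M.IsMaximal →
      ∃ x ∈ I, x.degree < g.natDegree ∧ ∃ k, x.coeff k ∉ M) (h : A[X]) :
    ∃ q : A[X], q.Monic ∧ q.natDegree = g.natDegree - 1 ∧ q - h ∈ I := by
  set m := g.natDegree with hmdef
  -- the ideal of coefficients in degree `m - 1`
  let L : Ideal A := Submodule.map (lcoeff A (m - 1)) (I.restrictScalars A ⊓ degreeLT A m)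
  have hL : ∀ x ∈ I, x.degree < m → x.coeff (m - 1) ∈ L := fun x hx hxm =>
    ⟨x, ⟨hx, mem_degreeLT.2 hxm⟩, rfl⟩
  have hcoeff : ∀ k, k < m → ∀ x ∈ I, x.degree < m → x.coeff (m - 1 - k) ∈ L := by
    intro k
    induction k with
    | zero => exact fun _ x hx hxm => hL x hx hxm
    | succ k ih =>
      intro hk x hx hxm
      -- multiplication by `X` modulo `g` shifts the coefficients up to multiples of the top one
      let y := X * x - C (x.coeff (m - 1)) * g
      have hyI : y ∈ I := I.sub_mem (I.mul_mem_left _ hx) (I.mul_mem_left _ hgI)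
      have hym : y.degree < m := by
        rw [degree_lt_iff_coeff_zero]
        intro j hj
        obtain ⟨j, rfl⟩ : ∃ i, j = i + 1 := ⟨j - 1, by omega⟩
        simp only [y, coeff_sub, coeff_X_mul, coeff_C_mul]
        rcases eq_or_lt_of_le hj with h | h
        · have h1 : g.coeff (j + 1) = 1 := by rw [← h]; exact hg
          have h2 : m - 1 = j := by omega
          rw [h1, h2, mul_one, sub_self]
        · rw [coeff_eq_zero_of_natDegree_lt (show g.natDegree < j + 1 from h),
            coeff_eq_zero_of_degree_lt (hxm.trans_le (by exact_mod_cast (by omega : m ≤ j)))]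
          simp
      have h1 := ih (by omega) y hyI hym
      have h2 : m - 1 - k = (m - 1 - (k + 1)) + 1 := by omega
      rw [h2] at h1
      simp only [y, coeff_sub, coeff_X_mul, coeff_C_mul] at h1
      have h3 := L.add_mem h1 (L.mul_mem_right (g.coeff (m - 1 - (k + 1) + 1)) (hL x hx hxm))
      rwa [sub_add_cancel] at h3
  have htop : L = ⊤ := by
    by_contra hne
    obtain ⟨M, hM, hLM⟩ := Ideal.exists_le_maximal L hne
    obtain ⟨x, hx, hxm, k, hk⟩ := hI M hM
    apply hk
    by_cases hkm : k < m
    · have := hcoeff (m - 1 - k) (by omega) x hx hxm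
      rw [show m - 1 - (m - 1 - k) = k by omega] at this
      exact hLM this
    · rw [coeff_eq_zero_of_degree_lt (hxm.trans_le (by exact_mod_cast (not_lt.1 hkm)))]
      exact M.zero_mem
  obtain ⟨p, ⟨hpI, hpm⟩, hp⟩ : (1 : A) ∈ L := htop ▸ Submodule.mem_top
  rw [SetLike.mem_coe, mem_degreeLT] at hpm
  replace hp : p.coeff (m - 1) = 1 := hp
  have hle : ∀ x : A[X], x.degree < m → x.degree ≤ ((m - 1 : ℕ) : WithBot ℕ) := fun x hx => by
    rw [degree_le_iff_coeff_zero]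
    intro j hj
    refine coeff_eq_zero_of_degree_lt (hx.trans_le ?_)
    have : m - 1 < j := by exact_mod_cast hj
    exact_mod_cast (by omega : m ≤ j)
  let q := h %ₘ g + C (1 - (h %ₘ g).coeff (m - 1)) * p
  have hqd : q.degree ≤ ((m - 1 : ℕ) : WithBot ℕ) := by
    refine (degree_add_le _ _).trans (max_le (hle _ ?_) ?_)
    · rw [hmdef, ← degree_eq_natDegree hg.ne_zero]
      exact degree_modByMonic_lt h hg
    · rw [← smul_eq_C_mul]
      exact hle _ ((degree_smul_le _ _).trans_lt hpm)
  have hqc : q.coeff (m - 1) = 1 := by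
    rw [coeff_add, coeff_C_mul, hp]; ring
  refine ⟨q, monic_of_degree_le _ hqd hqc, ?_, ?_⟩
  · exact natDegree_eq_of_degree_eq_some (degree_eq_of_le_of_coeff_ne_zero hqd (by simp [hqc]))
  · have : q - h = C (1 - (h %ₘ g).coeff (m - 1)) * p - g * (h /ₘ g) := by
      linear_combination modByMonic_add_div h g
    rw [this]
    exact I.sub_mem (I.mul_mem_left _ hpI) (I.mul_mem_right _ hgI)

theorem exists_monic_sub_mem [Nontrivial A] (I : Ideal A[X]) {p : A[X]} (hp : p.Monic) (hpI : p ∈ I)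
    (h : A[X]) : ∃ q : A[X], q.Monic ∧ 0 < q.natDegree ∧ q - h ∈ I := by
  have hmonic : (X ^ (h.natDegree + 1) * p).Monic := (monic_X_pow _).mul hp
  have hdeg : h.natDegree < (X ^ (h.natDegree + 1) * p).natDegree := by
    rw [(monic_X_pow _).natDegree_mul hp, natDegree_X_pow]
    omega
  refine ⟨h + X ^ (h.natDegree + 1) * p, hmonic.add_of_right (degree_lt_degree hdeg), ?_, ?_⟩
  · rw [natDegree_add_eq_right_of_natDegree_lt hdeg]
    omega
  · rw [add_sub_cancel_left]
    exact I.mul_mem_left _ hpI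

end Monic

/-! ### Rows over polynomial rings over local rings -/

section LocalRing

variable {A ι : Type*} [CommRing A] [Fintype ι] [DecidableEq ι]

theorem exists_ne_ne_of_card (h3 : 3 ≤ Fintype.card ι) (i j : ι) : ∃ k, i ≠ k ∧ j ≠ k := by
  obtain ⟨k, hk⟩ := Finset.exists_mem_notMem_of_card_lt_card (s := {i, j}) (t := Finset.univ)
    (lt_of_le_of_lt Finset.card_le_two (by rw [Finset.card_univ]; omega))
  simp only [Finset.mem_insert, Finset.mem_singleton, not_or] at hk
  exact ⟨k, fun h => hk.2.1 h.symm, fun h => hk.2.2 h.symm⟩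

namespace ElementarilyEquivalent

omit [CommRing A] [Fintype ι] in
theorem image_update_compl (v : ι → A) (j : ι) (y : A) :
    Function.update v j y '' {j}ᶜ = v '' {j}ᶜ :=
  Set.image_congr fun _ hm => Function.update_of_ne hm _ _

theorem update_of_sub_mem_span (v : ι → A) (j : ι) {q : A}
    (hq : q - v j ∈ Ideal.span (v '' {j}ᶜ)) :
    ElementarilyEquivalent v (Function.update v j q) := by
  simpa using update_add_of_mem_span v j hq

/-- The elementary form of **Horrocks' theorem** over a local ring, by Suslin's degree
reduction. -/
theorem single_of_monic [IsLocalRing A] (h3 : 3 ≤ Fintype.card ι) {x : ι → A[X]}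
    (hx : IsUnimodularRow x) {i : ι} (hi : (x i).Monic) (i₀ : ι) :
    ElementarilyEquivalent x (Pi.single i₀ 1) := by
  induction hm : (x i).natDegree using Nat.strong_induction_on generalizing x i with
  | _ m ih =>
  rcases Nat.eq_zero_or_pos m with rfl | hpos
  · have h1 : x i = 1 := hi.natDegree_eq_zero.1 hm
    obtain ⟨k, hik, hk⟩ := exists_ne_ne_of_card h3 i i₀
    exact (single_of_eq_one h1 hik).trans (single_of_eq_one (k := k) (by simp) hk.symm)
  let φ := mapRingHom (IsLocalRing.residue A)
  -- some other entry does not vanish modulo `x i` and the maximal ideal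
  obtain ⟨j, hj⟩ := (hx.map φ).exists_notMem (P := Ideal.span {φ (x i)}) (by
    rw [Ne, Ideal.span_singleton_eq_top]
    intro hu
    have h1 := natDegree_eq_zero_of_isUnit hu
    simp only [φ, coe_mapRingHom] at h1
    rw [hi.natDegree_map] at h1
    omega)
  have hij : i ≠ j := by
    rintro rfl
    exact hj (Ideal.mem_span_singleton_self _)
  obtain ⟨k, hik, hjk⟩ := exists_ne_ne_of_card h3 i j
  let I := Ideal.span {x i, x j}
  have hiI : x i ∈ I := Ideal.subset_span (by simp)
  have hjI : x j ∈ I := Ideal.subset_span (by simp)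
  have hr : x j %ₘ x i ∈ I := by
    rw [modByMonic_eq_sub_mul_div]
    exact I.sub_mem hjI (I.mul_mem_right _ hiI)
  have hcoeff : ∃ l, (x j %ₘ x i).coeff l ∉ IsLocalRing.maximalIdeal A := by
    by_contra! h
    apply hj
    have h0 : φ (x j %ₘ x i) = 0 := by
      ext l
      simpa [φ, coeff_map, IsLocalRing.residue_eq_zero_iff] using h l
    rw [← modByMonic_add_div (x j) (x i), map_add, h0, zero_add, map_mul]
    exact Ideal.mul_mem_right _ _ (Ideal.mem_span_singleton_self _)
  obtain ⟨q, hqm, hqd, hq⟩ := exists_monic_natDegree_pred_sub_mem I hi hiI (hm ▸ hpos)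
    (fun M hM => ⟨_, hr, by
      rw [← degree_eq_natDegree hi.ne_zero]
      exact degree_modByMonic_lt _ hi, by rwa [IsLocalRing.eq_maximalIdeal hM]⟩) (x k)
  have hIle : I ≤ Ideal.span (x '' {k}ᶜ) := by
    refine Ideal.span_mono ?_
    rintro _ (rfl | rfl)
    · exact ⟨i, hik, rfl⟩
    · exact ⟨j, hjk, rfl⟩
  have hxk := update_of_sub_mem_span x k (hIle hq)
  exact hxk.trans (ih (m - 1) (by omega) (hxk.isUnimodularRow hx) (i := k) (by simpa using hqm)
    (by rw [Function.update_self, hqd, hm]))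

/-- **Suslin's transitivity theorem** for polynomial rings in one variable over a Noetherian
local ring. -/
theorem single_of_card [IsLocalRing A] [IsNoetherianRing A] {n : ℕ} (hdim : ringKrullDim A ≤ n)
    (hn : n + 2 ≤ Fintype.card ι) (h3 : 3 ≤ Fintype.card ι) {x : ι → A[X]}
    (hx : IsUnimodularRow x) (i : ι) : ElementarilyEquivalent x (Pi.single i 1) := by
  obtain ⟨l, hl⟩ := exists_add_mul_card_le_height (Finset.univ.erase i) (x i) x
  have h1 := add_smul_of_ne x i l (Finset.univ.erase i) (by simp)
  set x' : ι → A[X] := fun k => if k ∈ Finset.univ.erase i then x k + l k * x i else x k with hx'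
  have hxi : x' i = x i := by simp [hx']
  have hx'u := h1.isUnimodularRow hx
  obtain ⟨p, hpI, hp⟩ := exists_monic_mem_of_forall_prime (Ideal.span (x' '' {i}ᶜ))
    fun P hP hle => by
      have hmem : ∀ k, k ≠ i → x' k ∈ P := fun k hk => hle (Ideal.subset_span ⟨k, hk, rfl⟩)
      have hiP : x i ∉ P := by
        obtain ⟨k, hk⟩ := hx'u.exists_notMem hP.ne_top
        by_cases h : k = i
        · rwa [h, hxi] at hk
        · exact absurd (hmem k h) hk
      refine exists_monic_mem_of_height hdim P (le_trans ?_ (hl P hP hiP fun k hk => ?_))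
      · rw [Finset.card_erase_of_mem (Finset.mem_univ i), Finset.card_univ]
        exact_mod_cast (by omega : n + 1 ≤ Fintype.card ι - 1)
      · have := hmem k (Finset.ne_of_mem_erase hk)
        simpa only [hx', if_pos hk] using this
  obtain ⟨q, hqm, -, hq⟩ := exists_monic_sub_mem _ hp hpI (x' i)
  have h2 := update_of_sub_mem_span x' i hq
  exact h1.trans (h2.trans
    (single_of_monic h3 (h2.isUnimodularRow hx'u) (i := i) (by simpa using hqm) i))

end ElementarilyEquivalent

end LocalRing

/-! ### Clearing denominators -/

section Localization

variable {R A : Type*} [CommRing R] [CommRing A] [Algebra R A]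

theorem exists_map_eq_of_mem_map (c : R) [IsLocalization.Away c A] (I : Ideal R[X]) {z : A[X]}
    (hz : z ∈ I.map (mapRingHom (algebraMap R A))) :
    ∃ n : ℕ, ∃ y ∈ I, y.map (algebraMap R A) = C (algebraMap R A (c ^ n)) * z := by
  let _ : Algebra R[X] A[X] := Polynomial.algebra R A
  have _ : IsLocalization ((Submonoid.powers c).map C) A[X] := Polynomial.isLocalization _ _
  obtain ⟨⟨y, ⟨_, _, ⟨n, rfl⟩, rfl⟩⟩, h⟩ :=
    (IsLocalization.mem_map_algebraMap_iff ((Submonoid.powers c).map C) A[X]).1 hz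
  refine ⟨n, y, y.2, ?_⟩
  have h' : z * mapRingHom (algebraMap R A) (C (c ^ n)) = mapRingHom (algebraMap R A) y := h
  rw [coe_mapRingHom, map_C] at h'
  rw [← h', mul_comm]

variable {ι : Type*} [Fintype ι] [DecidableEq ι]

/-- An operation over the localization `A = R[1/c]` on the entry `x_j` descends to `R` up to a
power of `c`, provided another entry is coprime to `c`. -/
theorem ElementarilyEquivalent.exists_update_map_eq (c : R) [IsLocalization.Away c A]
    {x : ι → R[X]} (hx : IsUnimodularRow x) {i j k : ι} (hij : i ≠ j) (hik : i ≠ k) (hjk : j ≠ k)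
    (hc : IsCoprime (x i) (C c)) {q : A[X]}
    (hq : q - (x j).map (algebraMap R A) ∈
      (Ideal.span (x '' {j}ᶜ)).map (mapRingHom (algebraMap R A))) :
    ∃ (n : ℕ) (Q : R[X]), Q.map (algebraMap R A) = C (algebraMap R A (c ^ n)) * q ∧
      ElementarilyEquivalent x (Function.update x j Q) := by
  obtain ⟨n, y, hy, hyq⟩ := exists_map_eq_of_mem_map c _ hq
  refine ⟨2 * n, C c ^ (2 * n) * x j + C c ^ n * y, ?_, ?_⟩
  · rw [Polynomial.map_add, Polynomial.map_mul, Polynomial.map_mul, hyq]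
    simp only [Polynomial.map_pow, map_C, map_pow]
    ring
  · have h1 := update_pow_mul hx hij hik hjk hc n
    refine h1.trans ?_
    have h2 := update_of_sub_mem_span (Function.update x j (C c ^ (2 * n) * x j)) j
      (q := C c ^ (2 * n) * x j + C c ^ n * y) (by
        rw [Function.update_self, add_sub_cancel_left]
        refine Ideal.mul_mem_left _ _ ?_
        rwa [image_update_compl])
    rwa [Function.update_idem] at h2

theorem natDegree_leadingCoeff_of_map_eq {c : R} [Nontrivial A]
    (hinj : Function.Injective (algebraMap R A)) {n : ℕ} {Q : R[X]} {q : A[X]} (hq : q.Monic)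
    (hQ : Q.map (algebraMap R A) = C (algebraMap R A (c ^ n)) * q)
    (hc : algebraMap R A (c ^ n) ≠ 0) :
    Q.natDegree = q.natDegree ∧ Q.leadingCoeff = c ^ n := by
  have hl : (C (algebraMap R A (c ^ n)) * q).leadingCoeff = algebraMap R A (c ^ n) := by
    rw [leadingCoeff_mul_monic hq, leadingCoeff_C]
  constructor
  · rw [← natDegree_map_eq_of_injective hinj, hQ, natDegree_mul' (by
      rw [leadingCoeff_C, hq.leadingCoeff, mul_one]; exact hc),
      natDegree_C, zero_add]
  · apply hinj
    rw [← leadingCoeff_map_of_injective hinj, hQ, hl]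

end Localization

/-! ### Making the leading coefficient of an entry a power of `c` -/

section AwayFromNonZeroDivisor

theorem IsCoprime.add_mul_mul_left {S : Type*} [CommRing S] {x c : S} (h : IsCoprime x c) (y z : S) :
    IsCoprime (x + y * c * z) c := by
  have : x + y * c * z = x + (y * z) * c := by ring
  rw [this]
  exact h.add_mul_right_left _

variable {R : Type*} [CommRing R]
variable (A : Type*) [CommRing A] [Algebra R A] (c : R) [IsLocalization.Away c A]

theorem injective_algebraMap_away (hc : c ∈ nonZeroDivisors R) :
    Function.Injective (algebraMap R A) := by
  refine IsLocalization.injective A (M := Submonoid.powers c) ?_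
  rintro _ ⟨n, rfl⟩
  exact pow_mem hc n

theorem isUnit_algebraMap_pow (n : ℕ) :
    IsUnit (algebraMap R A (c ^ n)) := by
  rw [map_pow]
  exact (IsLocalization.Away.algebraMap_isUnit c).pow n

theorem notMem_under_of_away (M : Ideal A) (hM : M ≠ ⊤) :
    c ∉ M.comap (algebraMap R A) := fun h =>
  hM (Ideal.eq_top_of_isUnit_mem _ h (IsLocalization.Away.algebraMap_isUnit c))

theorem ringKrullDim_away_le {n : ℕ}
    (hht : ∀ P : Ideal R, P.IsPrime → c ∉ P → P.height ≤ n) : ringKrullDim A ≤ n := by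
  refine (ringKrullDim_le_iff_height_le _).2 fun M hM => ?_
  have h := hht (M.under R) inferInstance (notMem_under_of_away A c M hM.ne_top)
  rw [IsLocalization.height_under (Submonoid.powers c)] at h
  exact_mod_cast h

variable {A} {c}

/-- A polynomial whose leading coefficient is a power of `c` is associated to a monic polynomial
over `R[1/c]`. -/
theorem exists_monic_map_eq [Nontrivial A] (hc : c ∈ nonZeroDivisors R) {g : R[X]} {e : ℕ}
    (hg : g.leadingCoeff = c ^ e) : ∃ g₁ : A[X], g₁.Monic ∧ g₁.natDegree = g.natDegree ∧
      g.map (algebraMap R A) = C (algebraMap R A (c ^ e)) * g₁ := by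
  have hinj := injective_algebraMap_away A c hc
  obtain ⟨u, hu⟩ := isUnit_algebraMap_pow A c e
  have hl : (g.map (algebraMap R A)).leadingCoeff = u := by
    rw [leadingCoeff_map_of_injective hinj, hg, hu]
  have hm : (C (↑u⁻¹ : A) * g.map (algebraMap R A)).Monic :=
    monic_C_mul_of_mul_leadingCoeff_eq_one (by rw [hl, Units.inv_mul])
  have he : g.map (algebraMap R A) =
      C (algebraMap R A (c ^ e)) * (C (↑u⁻¹ : A) * g.map (algebraMap R A)) := by
    rw [← hu, ← mul_assoc, ← C_mul, Units.mul_inv, C_1, one_mul]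
  refine ⟨_, hm, ?_, he⟩
  exact (natDegree_leadingCoeff_of_map_eq hinj hm he (hu ▸ u.ne_zero)).1.symm

variable {ι : Type*} [Fintype ι] [DecidableEq ι]

open ElementarilyEquivalent

/-- Multiples of `c x_j` are added to the other entries so that the ideal they generate contains a
monic polynomial over `R[1/c]`; a large multiple of it, up to a power of `c`, is added to `x_j`. -/
theorem exists_equivalent_leadingCoeff_eq_pow [IsNoetherianRing R] [Nontrivial R]
    (hc : c ∈ nonZeroDivisors R) {n : ℕ}
    (hht : ∀ P : Ideal R, P.IsPrime → c ∉ P → P.height ≤ n) (hn : Fintype.card ι = n + 2)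
    {x : ι → R[X]} (hx : IsUnimodularRow x) {i j k : ι} (hij : i ≠ j) (hik : i ≠ k) (hjk : j ≠ k)
    (hi : IsCoprime (x i) (C c)) :
    ∃ x' : ι → R[X], ElementarilyEquivalent x x' ∧ IsCoprime (x' i) (C c) ∧
      0 < (x' j).natDegree ∧ ∃ e : ℕ, (x' j).leadingCoeff = c ^ e := by
  let A := Localization.Away c
  have hinj := injective_algebraMap_away A c hc
  have : Nontrivial A := hinj.nontrivial
  have : IsNoetherianRing A := IsLocalization.isNoetherianRing (Submonoid.powers c) A inferInstance
  have hdim := ringKrullDim_away_le A c hht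
  obtain ⟨l, hl⟩ := exists_add_mul_card_le_height (Finset.univ.erase j) (C c * x j) x
  have h1 := add_smul_of_ne x j (fun m => l m * C c) (Finset.univ.erase j) (by simp)
  set x₁ : ι → R[X] := fun m => if m ∈ Finset.univ.erase j then x m + l m * C c * x j else x m
    with hx₁
  have hx₁j : x₁ j = x j := by simp [hx₁]
  have hx₁u := h1.isUnimodularRow hx
  have hx₁i : IsCoprime (x₁ i) (C c) := by
    simp only [hx₁, Finset.mem_erase, ne_eq, hij, not_false_eq_true, Finset.mem_univ, and_self,
      if_true]
    exact hi.add_mul_mul_left _ _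
  let I := Ideal.span (x₁ '' {j}ᶜ)
  obtain ⟨p, hpI, hp⟩ := exists_monic_mem_of_forall_prime
    (I.map (mapRingHom (algebraMap R A))) fun P hP hle => by
      let P₀ := P.comap (mapRingHom (algebraMap R A))
      have hP₀ : P₀.IsPrime := Ideal.comap_isPrime _ _
      have hle₀ : I ≤ P₀ := Ideal.map_le_iff_le_comap.1 hle
      have hmem : ∀ m, m ≠ j → x₁ m ∈ P₀ := fun m hm => hle₀ (Ideal.subset_span ⟨m, hm, rfl⟩)
      have hcP : C c ∉ P₀ := fun h => hP.ne_top (Ideal.eq_top_of_isUnit_mem _ h (by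
        rw [coe_mapRingHom, map_C]
        exact (IsLocalization.Away.algebraMap_isUnit c).map C))
      have hjP : x j ∉ P₀ := by
        obtain ⟨m, hm⟩ := hx₁u.exists_notMem hP₀.ne_top
        by_cases h : m = j
        · rwa [h, hx₁j] at hm
        · exact absurd (hmem m h) hm
      have hheight := hl P₀ hP₀ (fun h => (hP₀.mem_or_mem h).elim hcP hjP) fun m hm => by
        have := hmem m (Finset.ne_of_mem_erase hm)
        simpa only [hx₁, if_pos hm, mul_assoc] using this
      rw [Finset.card_erase_of_mem (Finset.mem_univ j), Finset.card_univ, hn] at hheight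
      have hPP₀ : P₀.height = P.height := by
        let _ : Algebra R[X] A[X] := Polynomial.algebra R A
        have _ : IsLocalization ((Submonoid.powers c).map C) A[X] :=
          Polynomial.isLocalization _ _
        exact IsLocalization.height_under ((Submonoid.powers c).map C) P
      exact exists_monic_mem_of_height hdim P (hPP₀ ▸ hheight)
  obtain ⟨q, hqm, hqd, hq⟩ := exists_monic_sub_mem _ hp hpI ((x₁ j).map (algebraMap R A))
  obtain ⟨e, Q, hQ, h2⟩ := exists_update_map_eq (A := A) c hx₁u hij hik hjk hx₁i hq
  obtain ⟨hQd, hQl⟩ := natDegree_leadingCoeff_of_map_eq hinj hqm hQ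
    (isUnit_algebraMap_pow A c e).ne_zero
  refine ⟨_, h1.trans h2, ?_, ?_, e, ?_⟩
  · rwa [Function.update_of_ne hij]
  · rwa [Function.update_self, hQd]
  · rwa [Function.update_self]

end AwayFromNonZeroDivisor

/-! ### Lowering the degree of an entry -/

section DegreeReduction

/-- If `g` is monic and the row `(g, h, r_k)` is unimodular, then some constant `s` in the ideal
`(g, h)` is comaximal with the coefficients of the remainders `r_k mod g`. This is lying over for
the integral extension `A → A[X]/(g)`. -/
theorem exists_C_mem_span_pair {A κ : Type*} [CommRing A] {g : A[X]} (hg : g.Monic) (h : A[X])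
    (r : κ → A[X])
    (hunit : ∀ P : Ideal A[X], P.IsPrime → g ∈ P → h ∈ P → ∃ k, r k ∉ P) :
    ∃ s : A, C s ∈ Ideal.span {g, h} ∧
      ∀ M : Ideal A, M.IsMaximal → s ∈ M → ∃ k l, (r k %ₘ g).coeff l ∉ M := by
  let 𝔠 : Ideal A := Ideal.span {a | ∃ k l, a = (r k %ₘ g).coeff l}
  let 𝔞 : Ideal A := (Ideal.span {AdjoinRoot.mk g h}).comap (algebraMap A (AdjoinRoot g))
  have : Module.Finite A (AdjoinRoot g) := hg.finite_adjoinRoot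
  have htop : 𝔞 ⊔ 𝔠 = ⊤ := by
    by_contra hne
    obtain ⟨M, hM, hle⟩ := Ideal.exists_le_maximal _ hne
    obtain ⟨Q, hQ, hQp, hQM⟩ := Ideal.exists_ideal_over_prime_of_isIntegral M
      (Ideal.span {AdjoinRoot.mk g h}) (le_sup_left.trans hle)
    let P := Q.comap (AdjoinRoot.mk g)
    have hP : P.IsPrime := Ideal.comap_isPrime _ _
    have hgP : g ∈ P := by
      rw [Ideal.mem_comap, AdjoinRoot.mk_self]
      exact Q.zero_mem
    obtain ⟨k, hk⟩ := hunit P hP hgP (hQ (Ideal.mem_span_singleton_self _))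
    apply hk
    have hmap : M.map C ≤ P := by
      rw [Ideal.map_le_iff_le_comap]
      intro a ha
      rw [← hQM] at ha
      exact ha
    rw [← modByMonic_add_div (r k) g]
    refine P.add_mem (hmap (Ideal.mem_map_C_iff.2 fun l => ?_)) (P.mul_mem_right _ hgP)
    exact hle (Ideal.mem_sup_right (Ideal.subset_span ⟨k, l, rfl⟩))
  obtain ⟨s, hs, t, ht, hst⟩ := Submodule.mem_sup.1 (htop ▸ Submodule.mem_top : (1 : A) ∈ 𝔞 ⊔ 𝔠)
  refine ⟨s, ?_, fun M hM hsM => ?_⟩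
  · obtain ⟨b, hb⟩ := Ideal.mem_span_singleton'.1 hs
    obtain ⟨b, rfl⟩ := AdjoinRoot.mk_surjective b
    rw [← map_mul] at hb
    obtain ⟨a, ha⟩ := AdjoinRoot.mk_eq_mk.1 (hb.trans (AdjoinRoot.mk_C s).symm)
    rw [Ideal.mem_span_pair]
    exact ⟨-a, b, by linear_combination ha⟩
  · by_contra! hcon
    have h𝔠 : 𝔠 ≤ M := Ideal.span_le.2 (by rintro _ ⟨k, l, rfl⟩; exact hcon k l)
    exact hM.ne_top ((Ideal.eq_top_iff_one _).2 (hst ▸ M.add_mem hsM (h𝔠 ht)))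

variable {R : Type*} [CommRing R] {c : R} {ι : Type*} [Fintype ι] [DecidableEq ι]

open ElementarilyEquivalent

/-- The entry `x_j`, whose leading coefficient is a power of `c`, can be replaced by one of degree
one less. Multiples of `c x_k` are added to the remaining `n` entries so that the coefficients of
their remainders modulo `x_j`, at least `2 n > dim R[1/c]` in number, generate the unit ideal of
`R[1/c]`; then `x_k` can be given degree one less than `x_j` by Suslin's degree reduction. -/
theorem exists_equivalent_natDegree_eq_pred [IsNoetherianRing R] [Nontrivial R]
    (hc : c ∈ nonZeroDivisors R) {n : ℕ} (hn1 : 1 ≤ n)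
    (hht : ∀ P : Ideal R, P.IsPrime → c ∉ P → P.height ≤ n) (hn : Fintype.card ι = n + 2)
    {x : ι → R[X]} (hx : IsUnimodularRow x) {i j k : ι} (hij : i ≠ j) (hik : i ≠ k) (hjk : j ≠ k)
    (hi : IsCoprime (x i) (C c)) {e : ℕ} (he : (x j).leadingCoeff = c ^ e)
    (hm : 2 ≤ (x j).natDegree) :
    ∃ x' : ι → R[X], ElementarilyEquivalent x x' ∧ IsCoprime (x' i) (C c) ∧
      (x' j).natDegree = (x j).natDegree - 1 ∧ ∃ e : ℕ, (x' j).leadingCoeff = c ^ e := by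
  let A := Localization.Away c
  let α := algebraMap R A
  have hinj : Function.Injective α := injective_algebraMap_away A c hc
  have : Nontrivial A := hinj.nontrivial
  obtain ⟨g, hgm, hgd, hg⟩ := exists_monic_map_eq (A := A) hc he
  set m := (x j).natDegree with hmdef
  obtain ⟨ue, hue⟩ := isUnit_algebraMap_pow A c e
  have hgj : g = C (↑ue⁻¹ : A) * (x j).map α := by
    rw [hg, ← hue, ← mul_assoc, ← C_mul, Units.inv_mul, C_1, one_mul]
  let S : Finset ι := (Finset.univ.erase j).erase k
  have hS : ∀ l, l ∈ S ↔ l ≠ k ∧ l ≠ j := fun l => by simp [S]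
  have hcard : S.card = n := by
    rw [Finset.card_erase_of_mem (by simp [hjk.symm]), Finset.card_erase_of_mem (by simp),
      Finset.card_univ, hn]
    rfl
  -- a constant `s ∈ (x_j, x_k)` over the localization, and a numerator `s₀` of it
  obtain ⟨s, hs, hsM⟩ := exists_C_mem_span_pair hgm ((x k).map α)
    (fun l : S => (x l).map α) (by
      intro P hP hgP hkP
      obtain ⟨l, hl⟩ := (hx.map (mapRingHom α)).exists_notMem hP.ne_top
      have hlj : l ≠ j := by
        rintro rfl
        apply hl
        rw [coe_mapRingHom, hg]
        exact P.mul_mem_left _ hgP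
      have hlk : l ≠ k := by
        rintro rfl
        exact hl hkP
      exact ⟨⟨l, (hS l).2 ⟨hlk, hlj⟩⟩, hl⟩)
  have hs' : C s ∈ (Ideal.span {x j, x k}).map (mapRingHom α) := by
    refine (Ideal.span_le.2 ?_) hs
    rintro _ (rfl | rfl)
    · rw [hgj]
      exact Ideal.mul_mem_left _ _ (Ideal.mem_map_of_mem (mapRingHom α)
        (Ideal.subset_span (by simp)))
    · exact Ideal.mem_map_of_mem (mapRingHom α) (Ideal.subset_span (by simp))
  obtain ⟨N, y, hy, hyN⟩ := exists_map_eq_of_mem_map c _ hs'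
  obtain ⟨s₀, rfl⟩ : ∃ s₀, y = C s₀ := by
    refine ⟨y.coeff 0, eq_C_of_natDegree_eq_zero ?_⟩
    rw [← natDegree_map_eq_of_injective hinj, hyN, ← C_mul, natDegree_C]
  rw [map_C, ← C_mul, C_inj] at hyN
  obtain ⟨a₀, b₀, hab⟩ := Ideal.mem_span_pair.1 hy
  -- numerators of the coefficients of the remainders
  let J : Finset (ι × ℕ) := S ×ˢ Finset.range m
  let r : ι → A[X] := fun l => (x l).map α %ₘ g
  obtain ⟨⟨b, hbmem⟩, hb⟩ := IsLocalization.exist_integer_multiples (Submonoid.powers c) J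
    (fun p => (r p.1).coeff p.2)
  obtain ⟨nb, rfl⟩ := hbmem
  choose! Y hY using hb
  replace hY : ∀ p ∈ J, α (Y p) = α (c ^ nb) * (r p.1).coeff p.2 := fun p hp => by
    rw [← Algebra.smul_def]
    exact hY p hp
  obtain ⟨ν, hν⟩ := exists_add_mul_card_le_height J (c ^ nb * (c * s₀)) Y
  let ν' : ι → R[X] := fun l => ∑ p ∈ Finset.range m, C (ν (l, p)) * X ^ p
  have hν'c : ∀ l, ∀ p ∈ Finset.range m, (ν' l).coeff p = ν (l, p) := fun l p hp => by
    simp only [ν', finsetSum_coeff, coeff_C_mul_X_pow]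
    rw [Finset.sum_ite_eq, if_pos hp]
  have hν'd : ∀ l, (ν' l).degree < m := fun l => by
    refine (degree_sum_le _ _).trans_lt ((Finset.sup_lt_iff (WithBot.bot_lt_coe m)).2 ?_)
    intro p hp
    exact (degree_C_mul_X_pow_le _ _).trans_lt (WithBot.coe_lt_coe.2 (Finset.mem_range.1 hp))
  have h1 := add_smul_of_ne x k (fun l => ν' l * b₀ * C c) S (by simp [S])
  set x₁ : ι → R[X] := fun l => if l ∈ S then x l + ν' l * b₀ * C c * x k else x l with hx₁
  have hx₁u := h1.isUnimodularRow hx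
  have hx₁j : x₁ j = x j := by simp [hx₁, S]
  have hx₁k : x₁ k = x k := by simp [hx₁, S]
  have hx₁i : IsCoprime (x₁ i) (C c) := by
    simp only [hx₁]
    split_ifs
    · exact hi.add_mul_mul_left _ _
    · exact hi
  -- the remainders of the new entries
  have hrem : ∀ l ∈ S, (x₁ l).map α %ₘ g = r l + C (α (c * s₀)) * (ν' l).map α := by
    intro l hl
    have hdeg : (r l + C (α (c * s₀)) * (ν' l).map α).degree < g.degree := by
      refine (degree_add_le _ _).trans_lt (max_lt (degree_modByMonic_lt _ hgm) ?_)
      rw [← smul_eq_C_mul]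
      refine (degree_smul_le _ _).trans_lt (degree_map_le.trans_lt ?_)
      rw [degree_eq_natDegree hgm.ne_zero, hgd]
      exact hν'd l
    refine (div_modByMonic_unique ((x l).map α /ₘ g - (ν' l).map α * C (α c) * a₀.map α *
      C (α (c ^ e))) _ hgm ⟨?_, hdeg⟩).2
    have hdiv : r l + g * ((x l).map α /ₘ g) = (x l).map α := modByMonic_add_div _ _
    have hab' : a₀.map α * (x j).map α + b₀.map α * (x k).map α = C (α s₀) := by
      rw [← Polynomial.map_mul, ← Polynomial.map_mul, ← Polynomial.map_add, hab, map_C]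
    rw [hg] at hab'
    simp only [hx₁, if_pos hl, Polynomial.map_add, Polynomial.map_mul, map_C, map_mul]
    linear_combination hdiv - (ν' l).map α * C (α c) * hab'
  let I : Ideal A[X] := (Ideal.span (x₁ '' {k}ᶜ)).map (mapRingHom α)
  have hmemI : ∀ l, l ≠ k → (x₁ l).map α ∈ I := fun l hl =>
    Ideal.mem_map_of_mem (mapRingHom α) (Ideal.subset_span ⟨l, hl, rfl⟩)
  have hgI : g ∈ I := by
    rw [hgj, ← hx₁j]
    exact I.mul_mem_left _ (hmemI j hjk)
  obtain ⟨q, hqm, hqd, hq⟩ := exists_monic_natDegree_pred_sub_mem I hgm hgI (by omega) (by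
    intro M hM
    by_contra! hcon
    have hrM : ∀ l ∈ S, ∀ p, ((x₁ l).map α %ₘ g).coeff p ∈ M := fun l hl p => by
      refine hcon _ ?_ ?_ p
      · rw [modByMonic_eq_sub_mul_div]
        exact I.sub_mem (hmemI l ((hS l).1 hl).1) (I.mul_mem_right _ hgI)
      · rw [← degree_eq_natDegree hgm.ne_zero]
        exact degree_modByMonic_lt _ hgm
    let P := M.comap α
    have hP : P.IsPrime := Ideal.comap_isPrime _ _
    have hcP : c ∉ P := notMem_under_of_away A c M hM.ne_top
    have hs₀P : s₀ ∉ P := by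
      intro hs₀
      have hsmem : s ∈ M := by
        have : α s₀ ∈ M := hs₀
        rw [hyN] at this
        exact (Ideal.unit_mul_mem_iff_mem M (isUnit_algebraMap_pow A c N)).1 this
      obtain ⟨⟨l, hl⟩, p, hp⟩ := hsM M hM hsmem
      apply hp
      have h2 := hrM l hl p
      rw [hrem l hl, coeff_add, coeff_C_mul, map_mul] at h2
      exact (Ideal.add_mem_iff_left M (M.mul_mem_right _ (M.mul_mem_left _ hs₀))).1 h2
    have hheight := hν P hP (fun h => by
      rcases hP.mem_or_mem h with h | h
      · exact hcP (hP.mem_of_pow_mem _ h)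
      · exact (hP.mem_or_mem h).elim hcP hs₀P) (by
      rintro ⟨l, p⟩ hp
      obtain ⟨hl, hpm⟩ := Finset.mem_product.1 hp
      have h2 := M.mul_mem_left (α (c ^ nb)) (hrM l hl p)
      rw [hrem l hl, coeff_add, coeff_C_mul, coeff_map, hν'c l p hpm, mul_add, ← hY _ hp] at h2
      change α _ ∈ M
      convert h2 using 1
      simp only [map_add, map_mul]
      ring)
    have h3 := hheight.trans (hht P hP hcP)
    rw [Finset.card_product, hcard, Finset.card_range] at h3
    have h4 : n * m ≤ n := by exact_mod_cast h3
    nlinarith) ((x₁ k).map α)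
  obtain ⟨e', Q, hQ, h2⟩ := exists_update_map_eq (A := A) c hx₁u hik hij hjk.symm hx₁i hq
  obtain ⟨hQd, hQl⟩ := natDegree_leadingCoeff_of_map_eq hinj hqm hQ
    (isUnit_algebraMap_pow A c e').ne_zero
  have h3 := swap (Function.update x₁ k Q) hjk
  refine ⟨_, h1.trans (h2.trans h3), ?_, ?_, e', ?_⟩
  · rwa [Function.update_of_ne hik, Function.update_of_ne hij, Function.update_of_ne hik]
  · rw [Function.update_of_ne hjk, Function.update_self, Function.update_self, hQd, hqd, hgd]
  · rw [Function.update_of_ne hjk, Function.update_self, Function.update_self, hQl]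

theorem exists_equivalent_natDegree_eq_one [IsNoetherianRing R] [Nontrivial R]
    (hc : c ∈ nonZeroDivisors R) {n : ℕ} (hn1 : 1 ≤ n)
    (hht : ∀ P : Ideal R, P.IsPrime → c ∉ P → P.height ≤ n) (hn : Fintype.card ι = n + 2)
    {x : ι → R[X]} (hx : IsUnimodularRow x) {i j k : ι} (hij : i ≠ j) (hik : i ≠ k) (hjk : j ≠ k)
    (hi : IsCoprime (x i) (C c)) :
    ∃ x' : ι → R[X], ElementarilyEquivalent x x' ∧ IsCoprime (x' i) (C c) ∧
      (x' j).natDegree = 1 ∧ ∃ e : ℕ, (x' j).leadingCoeff = c ^ e := by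
  obtain ⟨x₁, h1, hi₁, hm₁, e₁, he₁⟩ :=
    exists_equivalent_leadingCoeff_eq_pow hc hht hn hx hij hik hjk hi
  suffices H : ∀ (m : ℕ) (y : ι → R[X]), IsUnimodularRow y → IsCoprime (y i) (C c) →
      (y j).natDegree = m + 1 → (∃ e : ℕ, (y j).leadingCoeff = c ^ e) →
      ∃ x' : ι → R[X], ElementarilyEquivalent y x' ∧ IsCoprime (x' i) (C c) ∧
        (x' j).natDegree = 1 ∧ ∃ e : ℕ, (x' j).leadingCoeff = c ^ e by
    obtain ⟨x', h2, h3⟩ := H ((x₁ j).natDegree - 1) x₁ (h1.isUnimodularRow hx) hi₁ (by omega)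
      ⟨e₁, he₁⟩
    exact ⟨x', h1.trans h2, h3⟩
  intro m
  induction m with
  | zero => exact fun y _ hyi hyd hye => ⟨y, refl y, hyi, hyd, hye⟩
  | succ m ih =>
    rintro y hy hyi hyd ⟨e, hye⟩
    obtain ⟨z, hyz, hzi, hzd, hze⟩ :=
      exists_equivalent_natDegree_eq_pred hc hn1 hht hn hy hij hik hjk hyi hye (by omega)
    obtain ⟨x', h2, h3⟩ := ih z (hyz.isUnimodularRow hy) hzi (by omega) hze
    exact ⟨x', hyz.trans h2, h3⟩

end DegreeReduction

/-! ### Making the remaining entries constant -/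

section ConstantEntries

variable {R : Type*} [CommRing R] {c : R}

theorem mem_nonZeroDivisors_of_forall_notMem_minimalPrimes [IsReduced R] {a : R}
    (h : ∀ P ∈ minimalPrimes R, a ∉ P) : a ∈ nonZeroDivisors R := by
  refine mem_nonZeroDivisors_iff_right.2 fun z hz => ?_
  have hmem : z ∈ sInf (minimalPrimes R) := by
    rw [Ideal.mem_sInf]
    intro P hP
    refine (hP.1.1.mem_or_mem (show z * a ∈ P from hz ▸ P.zero_mem)).resolve_right (h P hP)
  rw [minimalPrimes, Ideal.sInf_minimalPrimes] at hmem
  exact (mem_nilradical.1 hmem).eq_zero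

variable {ι : Type*} [Fintype ι] [DecidableEq ι]

open ElementarilyEquivalent

/-- If `x_j` divides `X - b` over `A = R[1/c]`, then the entries other than
`x_i` and `x_j` may be replaced by constants, namely multiples by powers of `c` of their values
at `b`. -/
theorem exists_equivalent_eq_C {A : Type*} [CommRing A] [Algebra R A] [IsLocalization.Away c A]
    (hinj : Function.Injective (algebraMap R A)) {x : ι → R[X]} (hx : IsUnimodularRow x) {i j : ι}
    (hij : i ≠ j) (hi : IsCoprime (x i) (C c)) {b : A}
    (hb : X - C b ∈ Ideal.span {(x j).map (algebraMap R A)}) (T : Finset ι) (hiT : i ∉ T)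
    (hjT : j ∉ T) :
    ∃ x' : ι → R[X], ElementarilyEquivalent x x' ∧ (∀ l, l ∉ T → x' l = x l) ∧
      ∀ l ∈ T, ∃ (a : R) (n : ℕ), x' l = C a ∧
        algebraMap R A a = algebraMap R A (c ^ n) * eval b ((x l).map (algebraMap R A)) := by
  induction T using Finset.induction_on with
  | empty => exact ⟨x, refl x, fun _ _ => rfl, by simp⟩
  | insert w T hw ih =>
    simp only [Finset.mem_insert, not_or] at hiT hjT
    obtain ⟨x₁, h1, hx₁, hT⟩ := ih hiT.2 hjT.2
    have hq : C (eval b ((x w).map (algebraMap R A))) - (x₁ w).map (algebraMap R A) ∈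
        (Ideal.span (x₁ '' {w}ᶜ)).map (mapRingHom (algebraMap R A)) := by
      rw [hx₁ w hw, ← neg_sub, ← modByMonic_X_sub_C_eq_C_eval, modByMonic_eq_sub_mul_div,
        sub_sub_cancel]
      refine neg_mem (Ideal.mul_mem_right _ _ ?_)
      refine (Ideal.span_singleton_le_iff_mem _).2 ?_ hb
      exact Ideal.mem_map_of_mem (mapRingHom (algebraMap R A))
        (Ideal.subset_span ⟨j, hjT.1, hx₁ j hjT.2⟩)
    obtain ⟨n, Q, hQ, h2⟩ := exists_update_map_eq (A := A) c (h1.isUnimodularRow hx) hiT.1 hij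
      (Ne.symm hjT.1) (by rwa [hx₁ i hiT.2]) hq
    rw [← C_mul] at hQ
    have hQ0 : Q = C (Q.coeff 0) := eq_C_of_natDegree_eq_zero (by
      rw [← natDegree_map_eq_of_injective hinj, hQ, natDegree_C])
    refine ⟨_, h1.trans h2, fun l hl => ?_, fun l hl => ?_⟩
    · simp only [Finset.mem_insert, not_or] at hl
      rw [Function.update_of_ne hl.1, hx₁ l hl.2]
    · by_cases hlw : l = w
      · subst hlw
        refine ⟨Q.coeff 0, n, by rw [Function.update_self, ← hQ0], ?_⟩
        rw [hQ0, map_C, C_inj] at hQ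
        exact hQ
      · rw [Function.update_of_ne hlw]
        exact hT l ((Finset.mem_insert.1 hl).resolve_left hlw)

/-- Multiples of the other entries may be added to `x_t` so that its value at `b`, up to a power of
`c` an element of `R`, becomes a non-zero-divisor. -/
theorem exists_add_eval_mem_nonZeroDivisors [IsNoetherianRing R] [IsReduced R] {A : Type*}
    [CommRing A] [Algebra R A] [IsLocalization.Away c A] (hc : c ∈ nonZeroDivisors R)
    {x : ι → R[X]} (hx : IsUnimodularRow x) (t : ι) (b : A) :
    ∃ y ∈ Ideal.span (x '' {t}ᶜ), ∃ z ∈ nonZeroDivisors R, ∃ n : ℕ,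
      algebraMap R A z = algebraMap R A (c ^ n) * eval b ((x t + y).map (algebraMap R A)) := by
  obtain ⟨⟨d, hd⟩, hden⟩ := IsLocalization.exist_integer_multiples (Submonoid.powers c)
    (Finset.univ : Finset ι) (fun l => eval b ((x l).map (algebraMap R A)))
  obtain ⟨n, rfl⟩ := hd
  choose! Y hY using hden
  replace hY : ∀ l, algebraMap R A (Y l) =
      algebraMap R A (c ^ n) * eval b ((x l).map (algebraMap R A)) := fun l => by
    rw [← Algebra.smul_def]
    exact hY l (Finset.mem_univ l)
  let I := Ideal.span (Y '' {t}ᶜ)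
  have hfin : (minimalPrimes R).Finite := minimalPrimes.finite_of_isNoetherianRing R
  obtain ⟨z, hz, hzP⟩ := exists_add_notMem_of_incomparable hfin.toFinset
    (fun P hP => (hfin.mem_toFinset.1 hP).1.1)
    (fun P hP Q hQ hPQ => le_antisymm hPQ
      ((hfin.mem_toFinset.1 hQ).2 (hfin.mem_toFinset.1 hP).1 hPQ))
    (Y t) I (by
      intro P hP htP hIP
      have hPmin := hfin.mem_toFinset.1 hP
      have hPprime : P.IsPrime := hPmin.1.1
      have hall : ∀ l, Y l ∈ P := fun l => by
        by_cases h : l = t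
        · rwa [h]
        · exact hIP (Ideal.subset_span ⟨l, h, rfl⟩)
      have hcP : Disjoint (Submonoid.powers c : Set R) (P : Set R) := by
        refine Set.disjoint_left.2 ?_
        rintro _ ⟨e, rfl⟩ he
        exact Set.disjoint_left.1 (Ideal.disjoint_nonZeroDivisors_of_mem_minimalPrimes hPmin)
          (hPprime.mem_of_pow_mem _ he) hc
      have hPA : (P.map (algebraMap R A)).IsPrime :=
        IsLocalization.isPrime_of_isPrime_disjoint (Submonoid.powers c) A P hPprime hcP
      -- the row of values at `b` is unimodular over the localization
      obtain ⟨l, hl⟩ := (hx.map ((evalRingHom b).comp (mapRingHom (algebraMap R A)))).exists_notMem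
        hPA.ne_top
      apply hl
      have := Ideal.mem_map_of_mem (algebraMap R A) (hall l)
      rw [hY] at this
      exact (Ideal.unit_mul_mem_iff_mem _ (isUnit_algebraMap_pow A c n)).1 this)
  obtain ⟨y, hy, hyz⟩ : ∃ y ∈ Ideal.span (x '' {t}ᶜ), algebraMap R A z =
      algebraMap R A (c ^ n) * eval b (y.map (algebraMap R A)) := by
    refine Submodule.span_induction (p := fun z _ => ∃ y ∈ Ideal.span (x '' {t}ᶜ),
      algebraMap R A z = algebraMap R A (c ^ n) * eval b (y.map (algebraMap R A))) ?_ ?_ ?_ ?_ hz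
    · rintro _ ⟨l, hl, rfl⟩
      exact ⟨x l, Ideal.subset_span ⟨l, hl, rfl⟩, hY l⟩
    · exact ⟨0, Ideal.zero_mem _, by simp⟩
    · rintro z z' _ _ ⟨y, hy, h⟩ ⟨y', hy', h'⟩
      exact ⟨y + y', Ideal.add_mem _ hy hy', by
        rw [map_add, h, h', Polynomial.map_add, eval_add, mul_add]⟩
    · rintro a z _ ⟨y, hy, h⟩
      refine ⟨C a * y, Ideal.mul_mem_left _ _ hy, ?_⟩
      rw [smul_eq_mul, map_mul, h, Polynomial.map_mul, eval_mul, map_C, eval_C]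
      ring
  refine ⟨y, hy, Y t + z, ?_, n, ?_⟩
  · exact mem_nonZeroDivisors_of_forall_notMem_minimalPrimes fun P hP =>
      hzP P (hfin.mem_toFinset.2 hP)
  · rw [map_add, hY, hyz, Polynomial.map_add, eval_add, mul_add]

/-- A row with an entry coprime to `c` and a linear entry whose leading coefficient is a power of
`c` has the required normal form. -/
theorem exists_equivalent_eq_C_of_natDegree_eq_one [IsNoetherianRing R] [IsReduced R] [Nontrivial R]
    (hc : c ∈ nonZeroDivisors R) {x : ι → R[X]} (hx : IsUnimodularRow x) {i j t : ι}
    (hij : i ≠ j) (hit : i ≠ t) (hjt : j ≠ t) (hi : IsCoprime (x i) (C c)) {e : ℕ}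
    (he : (x j).leadingCoeff = c ^ e) (hd : (x j).natDegree = 1) :
    ∃ (x' : ι → R[X]) (a : ι → R), ElementarilyEquivalent x x' ∧ (x' j).degree = 1 ∧
      (∀ l, l ≠ i → l ≠ j → x' l = C (a l)) ∧ a t ∈ nonZeroDivisors R := by
  let A := Localization.Away c
  have hinj := injective_algebraMap_away A c hc
  have : Nontrivial A := hinj.nontrivial
  obtain ⟨g, hgm, hgd, hg⟩ := exists_monic_map_eq (A := A) hc he
  obtain ⟨b, rfl⟩ : ∃ b, g = X - C b := by
    refine ⟨-g.coeff 0, ?_⟩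
    rw [C_neg, sub_neg_eq_add]
    exact hgm.eq_X_add_C (hgd.trans hd)
  have hbmem : X - C b ∈ Ideal.span {(x j).map (algebraMap R A)} := by
    obtain ⟨u, hu⟩ := isUnit_algebraMap_pow A c e
    refine Ideal.mem_span_singleton'.2 ⟨C (↑u⁻¹ : A), ?_⟩
    rw [hg, ← hu, ← mul_assoc, ← C_mul, Units.inv_mul, C_1, one_mul]
  obtain ⟨y, hy, z, hz, n, hzy⟩ := exists_add_eval_mem_nonZeroDivisors hc hx t b
  have h1 := update_add_of_mem_span x t hy
  set x₁ := Function.update x t (x t + y) with hx₁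
  have hx₁j : x₁ j = x j := Function.update_of_ne hjt _ _
  obtain ⟨x', h2, hx', hC⟩ := exists_equivalent_eq_C (A := A) (c := c) hinj (h1.isUnimodularRow hx)
    hij (by rwa [hx₁, Function.update_of_ne hit]) (b := b) (by rwa [hx₁j])
    ((Finset.univ.erase i).erase j) (by simp) (by simp)
  choose! a m ha hma using hC
  refine ⟨x', a, h1.trans h2, ?_, fun l hli hlj => ha l (by simp [hli, hlj]), ?_⟩
  · rw [hx' j (by simp), hx₁j, degree_eq_natDegree (fun h => by simp [h] at hd), hd, Nat.cast_one]
  · have hat := hma t (by simp [hit.symm, hjt.symm])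
    rw [hx₁, Function.update_self] at hat
    have hmul : c ^ n * a t = c ^ m t * z := hinj (by
      rw [map_mul, map_mul, hat, hzy]
      ring)
    have hmem : c ^ n * a t ∈ nonZeroDivisors R := by
      rw [hmul]
      exact mul_mem (pow_mem hc _) hz
    exact (mul_mem_nonZeroDivisors.1 hmem).2

end ConstantEntries

/-! ### The normal form -/

/-- Rows of length `d + 1` are indexed by `0, 1, …, d`; `Function.update u 0 (C a * u 0)` is the
row `(a u_0, u_1, …, u_d)`. -/
theorem theorem3p3 {R : Type*} [CommRing R] [IsNoetherianRing R] [IsLocalRing R] [IsReduced R]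
    (d : ℕ) (hd : 2 ≤ d) (hdim : ringKrullDim R = (d : WithBot ℕ∞))
    (a : R) (ha : IsUnit a) (u : Fin (d + 1) → Polynomial R)
    (hu : IsUnimodularRow (Function.update u 0 (Polynomial.C a * u 0))) :
    ∃ (v : Fin (d + 1) → Polynomial R) (c : Fin (d + 1) → R),
      IsUnimodularRow v ∧
      (∀ i : Fin (d + 1), 2 ≤ (i : ℕ) → v i = Polynomial.C (c i)) ∧
      (v 1).degree = 1 ∧
      c (Fin.last d) ∈ nonZeroDivisors R ∧
      ElementarilyEquivalent (Function.update u 0 (Polynomial.C a * u 0))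
        (Function.update v 0 (Polynomial.C a * v 0)) := by
  obtain ⟨n, rfl⟩ : ∃ n, d = n + 1 := ⟨d - 1, by omega⟩
  have h𝔪 : (IsLocalRing.maximalIdeal R).height = (n + 1 : ℕ) := by
    have := IsLocalRing.maximalIdeal_height_eq_ringKrullDim (R := R)
    rw [hdim] at this
    exact_mod_cast this
  -- a non-zero-divisor in the maximal ideal
  have hfin : (minimalPrimes R).Finite := minimalPrimes.finite_of_isNoetherianRing R
  obtain ⟨s, hs𝔪, hsP⟩ := exists_add_notMem_of_incomparable hfin.toFinset
    (fun P hP => (hfin.mem_toFinset.1 hP).1.1)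
    (fun P hP Q hQ hPQ => le_antisymm hPQ
      ((hfin.mem_toFinset.1 hQ).2 (hfin.mem_toFinset.1 hP).1 hPQ))
    0 (IsLocalRing.maximalIdeal R) (by
      intro P hP _ hle
      have hPmin := hfin.mem_toFinset.1 hP
      have hPp : P.IsPrime := hPmin.1.1
      have h0 := Ideal.height_eq_zero_iff.2 hPmin
      have h1 := (Ideal.height_mono hle).trans_eq h0
      rw [h𝔪] at h1
      have h2 : n + 1 ≤ 0 := by exact_mod_cast h1
      omega)
  simp only [zero_add] at hsP
  have hs : s ∈ nonZeroDivisors R :=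
    mem_nonZeroDivisors_of_forall_notMem_minimalPrimes fun P hP => hsP P (hfin.mem_toFinset.2 hP)
  have hht : ∀ P : Ideal R, P.IsPrime → s ∉ P → P.height ≤ n := fun P hP hsP => by
    have hlt : P < IsLocalRing.maximalIdeal R :=
      lt_of_le_of_ne (IsLocalRing.le_maximalIdeal hP.ne_top) fun h => hsP (h ▸ hs𝔪)
    have := Ideal.height_add_one_le_of_lt_of_isPrime hlt
    rw [h𝔪] at this
    push_cast at this
    exact (ENat.add_le_add_iff_right (by simp)).1 this
  -- modulo `s` the row is equivalent to a coordinate row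
  let π := Ideal.Quotient.mk (Ideal.span {s})
  have hne : Ideal.span {s} ≠ ⊤ := fun h =>
    (IsLocalRing.mem_maximalIdeal s).1 hs𝔪 (Ideal.span_singleton_eq_top.1 h)
  have : Nontrivial (R ⧸ Ideal.span {s}) := Ideal.Quotient.nontrivial_iff.2 hne
  have : IsLocalRing (R ⧸ Ideal.span {s}) := IsLocalRing.of_surjective' π Ideal.Quotient.mk_surjective
  have hdimq : ringKrullDim (R ⧸ Ideal.span {s}) ≤ n := by
    have := (ringKrullDim_quotient_succ_le_of_nonZeroDivisor hs).trans_eq hdim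
    generalize ringKrullDim (R ⧸ Ideal.span {s}) = k at this ⊢
    induction k using WithBot.recBotCoe with
    | bot => exact bot_le
    | coe k =>
      have h : k + 1 ≤ (n + 1 : ℕ) := by exact_mod_cast this
      push_cast at h
      exact_mod_cast (ENat.add_le_add_iff_right (by simp)).1 h
  have hcard : Fintype.card (Fin (n + 1 + 1)) = n + 2 := by simp
  have h3 : 3 ≤ Fintype.card (Fin (n + 1 + 1)) := by omega
  have h01 : (0 : Fin (n + 1 + 1)) ≠ 1 := by simp
  have h0l : (0 : Fin (n + 1 + 1)) ≠ Fin.last (n + 1) := by simp [Fin.ext_iff]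
  have h1l : (1 : Fin (n + 1 + 1)) ≠ Fin.last (n + 1) := by
    simp only [ne_eq, Fin.ext_iff, Fin.val_one, Fin.val_last]
    omega
  obtain ⟨w, huw, hw⟩ := ElementarilyEquivalent.lift
    (Polynomial.map_surjective π Ideal.Quotient.mk_surjective : Function.Surjective (mapRingHom π))
    (ElementarilyEquivalent.single_of_card hdimq hcard.ge h3 (hu.map (mapRingHom π)) 0)
  have hw0 : IsCoprime (w 0) (C s) := by
    have hker : w 0 - 1 ∈ RingHom.ker (mapRingHom π) := by
      rw [RingHom.mem_ker, map_sub, hw, map_one, Pi.single_eq_same, sub_self]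
    rw [Polynomial.ker_mapRingHom, Ideal.mk_ker, Ideal.map_span, Set.image_singleton] at hker
    obtain ⟨y, hy⟩ := Ideal.mem_span_singleton'.1 hker
    exact ⟨1, -y, by linear_combination -hy⟩
  have hwu := huw.isUnimodularRow hu
  obtain ⟨x, hwx, hx0, hx1, e, he⟩ := exists_equivalent_natDegree_eq_one hs (by omega) hht hcard hwu
    h01 h0l h1l hw0
  obtain ⟨x', b, hxx', hdeg, hb, hbl⟩ := exists_equivalent_eq_C_of_natDegree_eq_one hs
    (hwx.isUnimodularRow hwu) h01 h0l h1l hx0 he hx1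
  have hux' := huw.trans (hwx.trans hxx')
  obtain ⟨a, rfl⟩ := ha
  have hx'0 : C (a : R) * (C (↑a⁻¹ : R) * x' 0) = x' 0 := by
    rw [← mul_assoc, ← C_mul, Units.mul_inv, C_1, one_mul]
  refine ⟨Function.update x' 0 (C (↑a⁻¹ : R) * x' 0), b, ?_, fun i hi => ?_, ?_, hbl, ?_⟩
  · obtain ⟨y, hy⟩ := hux'.isUnimodularRow hu
    refine ⟨Function.update y 0 (C (a : R) * y 0), ?_⟩
    rw [← hy]
    refine Finset.sum_congr rfl fun l _ => ?_
    by_cases hl : l = 0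
    · subst hl
      rw [Function.update_self, Function.update_self]
      linear_combination y 0 * hx'0
    · rw [Function.update_of_ne hl, Function.update_of_ne hl]
  · have hi0 : i ≠ 0 := by rintro rfl; simp at hi
    have hi1 : i ≠ 1 := by
      rintro rfl
      simp at hi
    rw [Function.update_of_ne hi0, hb i hi0 hi1]
  · rwa [Function.update_of_ne h01.symm]
  · rwa [Function.update_self, Function.update_idem, hx'0, Function.update_eq_self]
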